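/- Let $K_4=\{\pm1\}\times\{\pm1\}$ be the Klein four group, and write $H^*(-)$ for singular cohomology with coefficients in $\mathbb F_2$. For a $K_4$-space $X$ put $H^*_{K_4}(X)=H^*(EK_4\times_{K_4}X)$, let $\rho\colon H^*_{K_4}(X)\to H^*(X)$ be the restriction to the fibre, and let $r\colon H^*_{K_4}(X)\to H^*(X^{K_4}\times BK_4)\cong H^*(X^{K_4})\otimes H^*(BK_4)$ be the restriction to the fixed points. Write $H^*(BK_4)=\mathbb F_2[t,t']$ with $t,t'$ of degree one, and let $p_0=tt'(t+t')$ and $p_1=t^2+tt'+t'^2$ be the Dickson invariants. A quaternionic conjugation space (or $K_4$-conjugation space) is a $K_4$-space $X$ with $H^i(X)=0$ for all $i\not\equiv 0 \pmod 4$, equipped with additive isomorphisms $\kappa\colon H^{4n}(X)\to H^n(X^{K_4})$ for all $n\ge 0$ and an additive, degree-preserving section $\sigma\colon H^*(X)\to H^*_{K_4}(X)$ of $\rho$, such that for every $n\ge 0$ and every $x\in H^{4n}(X)$ there are classes $\kappa_{i,j}(x)\in H^{n+3i+j}(X^{K_4})$ with $$r(\sigma(x))=\kappa(x)\,p_0^{\,n}+\sum_{0<i+j\le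 n}\kappa_{i,j}(x)\,p_1^{\,j}\,p_0^{\,n-j-i}.$$ **Proposition.** Every quaternionic conjugation space $X$ is $K_4$-Galois-maximal, that is, $$\sum_{i\ge 0}\dim_{\mathbb F_2}H^i(X^{K_4};\mathbb F_2)=\frac12\sum_{i\ge 0}\dim_{\mathbb F_2}H^1\bigl(K_4;H^i(X;\mathbb F_2)\bigr),$$ where $K_4$ acts on $H^i(X;\mathbb F_2)$ by the action induced from $X$, and both sides are read in $[0,\infty]$. -/

import Mathlib

open scoped ENNReal lp

noncomputable section

namespace QuaternionicConjugation

universe u v w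

/-! ### Singular cohomology with coefficients in `𝔽₂` -/

/-- Singular `n`-simplices of a space. -/
abbrev Simplex (n : ℕ) (X : Type u) [TopologicalSpace X] : Type u :=
  C(stdSimplex ℝ (Fin (n + 1)), X)

section Singular

variable {X : Type u} {Y : Type v} {Z : Type w}
  [TopologicalSpace X] [TopologicalSpace Y] [TopologicalSpace Z]

/-- Precomposition of a singular simplex with the affine map of standard simplices given on
vertices by `φ`. -/
def Simplex.reindex {m n : ℕ} (φ : Fin (m + 1) → Fin (n + 1)) (s : Simplex n X) : Simplex m X :=
  s.comp ⟨stdSimplex.map φ, stdSimplex.continuous_map φ⟩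

theorem Simplex.reindex_reindex {l m n : ℕ} (φ : Fin (l + 1) → Fin (m + 1))
    (ψ : Fin (m + 1) → Fin (n + 1)) (s : Simplex n X) :
    (s.reindex ψ).reindex φ = s.reindex (ψ ∘ φ) := by
  ext x
  simp [Simplex.reindex, stdSimplex.map_comp_apply]

/-- The `i`-th face of a singular simplex. -/
def Simplex.face {n : ℕ} (i : Fin (n + 2)) (s : Simplex (n + 1) X) : Simplex n X :=
  s.reindex i.succAbove

/-- The face spanned by the first `p + 1` vertices of an `n`-simplex, where `p + q = n`. -/
def Simplex.front {p q n : ℕ} (h : p + q = n) (s : Simplex n X) : Simplex p X :=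
  s.reindex fun i => ⟨i, by omega⟩

/-- The face spanned by the last `q + 1` vertices of an `n`-simplex, where `p + q = n`. -/
def Simplex.back {p q n : ℕ} (h : p + q = n) (s : Simplex n X) : Simplex q X :=
  s.reindex fun i => ⟨p + i, by omega⟩

variable (X) in
/-- Singular `n`-cochains with values in `𝔽₂`. -/
abbrev Cochain (n : ℕ) : Type u := Simplex n X → ZMod 2

variable (X) in
/-- The singular coboundary (no signs are needed over `𝔽₂`). -/
def coboundary (n : ℕ) : Cochain X n →ₗ[ZMod 2] Cochain X (n + 1) where
  toFun f s := ∑ i : Fin (n + 2), f (s.face i)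
  map_add' f g := by ext s; simp [Finset.sum_add_distrib]
  map_smul' a f := by ext s; simp [Finset.mul_sum]

variable (X) in
/-- Singular `n`-cocycles. -/
def cocycles (n : ℕ) : Submodule (ZMod 2) (Cochain X n) := LinearMap.ker (coboundary X n)

variable (X) in
/-- Singular `n`-coboundaries. -/
def coboundaries : (n : ℕ) → Submodule (ZMod 2) (Cochain X n)
  | 0 => ⊥
  | n + 1 => LinearMap.range (coboundary X n)

variable (X) in
/-- Singular cohomology `Hⁿ(X; 𝔽₂)`. -/
abbrev H (n : ℕ) : Type u :=
  cocycles X n ⧸ (coboundaries X n).submoduleOf (cocycles X n)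

/-! ### Functoriality -/

/-- Pullback of cochains along a continuous map. -/
def Cochain.pullback (f : C(X, Y)) (n : ℕ) : Cochain Y n →ₗ[ZMod 2] Cochain X n where
  toFun c s := c (f.comp s)
  map_add' _ _ := rfl
  map_smul' _ _ := rfl

theorem Cochain.coboundary_pullback (f : C(X, Y)) (n : ℕ) (c : Cochain Y n) :
    coboundary X n (Cochain.pullback f n c) = Cochain.pullback f (n + 1) (coboundary Y n c) :=
  rfl

/-- Pullback of cocycles along a continuous map. -/
def cocyclesPullback (f : C(X, Y)) (n : ℕ) : cocycles Y n →ₗ[ZMod 2] cocycles X n :=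
  (Cochain.pullback f n).restrict fun c hc => by
    have hc' : coboundary Y n c = 0 := hc
    change coboundary X n (Cochain.pullback f n c) = 0
    rw [Cochain.coboundary_pullback, hc', map_zero]

/-- The map `f^* : Hⁿ(Y; 𝔽₂) → Hⁿ(X; 𝔽₂)` induced by a continuous map `f : X → Y`. -/
def pullback (f : C(X, Y)) (n : ℕ) : H Y n →ₗ[ZMod 2] H X n :=
  Submodule.mapQ _ _ (cocyclesPullback f n) fun c hc => by
    change Cochain.pullback f n c.1 ∈ coboundaries X n
    have hc' : c.1 ∈ coboundaries Y n := hc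
    cases n with
    | zero =>
      have h0 : c.1 = 0 := hc'
      rw [h0, map_zero]
      exact zero_mem _
    | succ n =>
      obtain ⟨b, hb⟩ := hc'
      exact ⟨Cochain.pullback f n b, by rw [Cochain.coboundary_pullback, hb]⟩

theorem pullback_id (n : ℕ) : pullback (ContinuousMap.id X) n = LinearMap.id := by
  ext c
  rfl

theorem pullback_comp (g : C(Y, Z)) (f : C(X, Y)) (n : ℕ) :
    pullback (g.comp f) n = pullback f n ∘ₗ pullback g n := by
  ext c
  rfl

/-! ### Cup products -/

variable (X) in
/-- The Alexander--Whitney cup product of cochains. -/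
def cochainCup {p q n : ℕ} (h : p + q = n) :
    Cochain X p →ₗ[ZMod 2] Cochain X q →ₗ[ZMod 2] Cochain X n :=
  LinearMap.mk₂ (ZMod 2) (fun f g s => f (s.front h) * g (s.back h))
    (fun _ _ _ => by ext s; simp [add_mul])
    (fun _ _ _ => by ext s; simp [mul_assoc])
    (fun _ _ _ => by ext s; simp [mul_add])
    (fun _ _ _ => by ext s; simp [mul_left_comm])

theorem cochainCup_apply {p q n : ℕ} (h : p + q = n) (f : Cochain X p) (g : Cochain X q)
    (s : Simplex n X) : cochainCup X h f g s = f (s.front h) * g (s.back h) := rfl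

/-- The Leibniz rule modulo two. -/
theorem coboundary_cup {p q n : ℕ} (h : p + q = n) (f : Cochain X p) (g : Cochain X q) :
    coboundary X n (cochainCup X h f g) =
      cochainCup X (by omega : (p + 1) + q = n + 1) (coboundary X p f) g +
        cochainCup X (by omega : p + (q + 1) = n + 1) f (coboundary X q g) := by
  subst h
  ext s
  have e1 : (p + 1) + q = p + q + 1 := by omega
  have e2 : p + (q + 1) = p + q + 1 := by omega
  -- each face of the product is a product of a face with the other factor
  have key : ∀ i : Fin (p + q + 2),
      f ((s.face i).front rfl) * g ((s.face i).back rfl) =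
        if hi : (i : ℕ) ≤ p then
          f ((s.front e1).face ⟨i, by omega⟩) * g (s.back e1)
        else f (s.front e2) * g ((s.back e2).face ⟨i - p, by omega⟩) := by
    intro i
    split_ifs with hi
    · congr 2
      · simp only [Simplex.face, Simplex.front, Simplex.reindex_reindex]
        congr 1
        ext j
        simp only [Function.comp, Fin.succAbove, Fin.lt_def, Fin.val_castSucc]
        split_ifs <;> simp
      · simp only [Simplex.face, Simplex.back, Simplex.reindex_reindex]
        congr 1
        ext j
        simp only [Function.comp, Fin.succAbove, Fin.lt_def, Fin.val_castSucc]
        split_ifs <;> simp <;> omega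
    · congr 2
      · simp only [Simplex.face, Simplex.front, Simplex.reindex_reindex]
        congr 1
        ext j
        simp only [Function.comp, Fin.succAbove, Fin.lt_def, Fin.val_castSucc]
        split_ifs <;> simp <;> omega
      · simp only [Simplex.face, Simplex.back, Simplex.reindex_reindex]
        congr 1
        ext j
        simp only [Function.comp, Fin.succAbove, Fin.lt_def, Fin.val_castSucc]
        split_ifs <;> simp <;> omega
  have last : (s.front e1).face (Fin.last (p + 1)) = s.front e2 := by
    simp only [Simplex.face, Simplex.front, Simplex.reindex_reindex]
    congr 1
    ext j
    simp [Function.comp]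
  have first : (s.back e2).face 0 = s.back e1 := by
    simp only [Simplex.face, Simplex.back, Simplex.reindex_reindex]
    congr 1
    ext j
    simp [Function.comp]
    omega
  simp only [coboundary, LinearMap.coe_mk, AddHom.coe_mk, Pi.add_apply, cochainCup_apply]
  rw [Fin.sum_univ_castSucc (n := p + 1), Fin.sum_univ_succ (n := q + 1), last, first,
    add_mul, mul_add, Finset.sum_mul, Finset.mul_sum]
  have two : ∀ x : ZMod 2, x + x = 0 := CharTwo.add_self_eq_zero
  have hsum : ∑ i : Fin (p + q + 2), f ((s.face i).front rfl) * g ((s.face i).back rfl) =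
      ∑ i : Fin (p + 1), f ((s.front e1).face i.castSucc) * g (s.back e1) +
        ∑ i : Fin (q + 1), f (s.front e2) * g ((s.back e2).face i.succ) := by
    have e3 : (p + 1) + (q + 1) = p + q + 2 := by omega
    rw [← (finCongr e3).sum_comp, Fin.sum_univ_add]
    congr 1
    · refine Finset.sum_congr rfl fun i _ => ?_
      rw [key, dif_pos (by simp; omega)]
      rfl
    · refine Finset.sum_congr rfl fun i _ => ?_
      rw [key, dif_neg (by simp; omega)]
      congr 3
      ext
      simp
      omega
  rw [hsum]
  linear_combination -(two (f (s.front e2) * g (s.back e1)))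

/-- The cup product of cocycles, as a cohomology class. -/
def cocycleCup {p q n : ℕ} (h : p + q = n) :
    cocycles X p →ₗ[ZMod 2] cocycles X q →ₗ[ZMod 2] H X n :=
  LinearMap.mk₂ (ZMod 2)
    (fun f g => Submodule.Quotient.mk ⟨cochainCup X h f g, by
      have hf : coboundary X p f.1 = 0 := f.2
      have hg : coboundary X q g.1 = 0 := g.2
      change coboundary X n _ = 0
      rw [coboundary_cup, hf, hg, map_zero, map_zero, LinearMap.zero_apply, add_zero]⟩)
    (fun f f' g => by
      rw [← Submodule.Quotient.mk_add]; congr 1; ext1; simp)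
    (fun a f g => by
      rw [← Submodule.Quotient.mk_smul]; congr 1; ext1; simp)
    (fun f g g' => by
      rw [← Submodule.Quotient.mk_add]; congr 1; ext1; simp)
    (fun a f g => by
      rw [← Submodule.Quotient.mk_smul]; congr 1; ext1; simp)

/-- The cup product `Hᵖ(X; 𝔽₂) × H^q(X; 𝔽₂) → Hⁿ(X; 𝔽₂)`, where `p + q = n`. -/
def cup {p q n : ℕ} (h : p + q = n) : H X p →ₗ[ZMod 2] H X q →ₗ[ZMod 2] H X n :=
  (Submodule.liftQ _
    (Submodule.liftQ _ (cocycleCup (X := X) h) (by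
      intro f hf
      have hf' : f.1 ∈ coboundaries X p := hf
      rw [LinearMap.mem_ker]
      ext g
      have hg : coboundary X q g.1 = 0 := g.2
      refine (Submodule.Quotient.mk_eq_zero _).2 ?_
      change cochainCup X h f.1 g.1 ∈ coboundaries X n
      cases p with
      | zero =>
        have h0 : f.1 = 0 := hf'
        rw [h0, map_zero, LinearMap.zero_apply]
        exact zero_mem _
      | succ p =>
        obtain ⟨b, hb⟩ := hf'
        obtain ⟨m, rfl⟩ : ∃ m, n = m + 1 := ⟨p + q, by omega⟩
        refine ⟨cochainCup X (by omega) b g.1, ?_⟩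
        rw [coboundary_cup, hb, hg, map_zero, add_zero])).flip (by
    intro g hg
    have hg' : g.1 ∈ coboundaries X q := hg
    rw [LinearMap.mem_ker]
    ext f
    have hf : coboundary X p f.1 = 0 := f.2
    refine (Submodule.Quotient.mk_eq_zero _).2 ?_
    change cochainCup X h f.1 g.1 ∈ coboundaries X n
    cases q with
    | zero =>
      have h0 : g.1 = 0 := hg'
      rw [h0, map_zero]
      exact zero_mem _
    | succ q =>
      obtain ⟨b, hb⟩ := hg'
      obtain ⟨m, rfl⟩ : ∃ m, n = m + 1 := ⟨p + q, by omega⟩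
      refine ⟨cochainCup X (by omega) f.1 b, ?_⟩
      rw [coboundary_cup, hb, hf, map_zero, LinearMap.zero_apply, zero_add])).flip

variable (X) in
/-- The unit class in `H⁰(X; 𝔽₂)`. -/
def unitClass : H X 0 :=
  Submodule.Quotient.mk ⟨fun _ => 1, by
    change coboundary X 0 _ = 0
    ext s
    simp only [coboundary, LinearMap.coe_mk, AddHom.coe_mk, Pi.zero_apply]
    exact CharTwo.add_self_eq_zero 1⟩

/-- The cup power `xⁿ ∈ H^{dn}(X; 𝔽₂)` of a class `x ∈ H^d(X; 𝔽₂)`. -/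
def cupPow {d : ℕ} (x : H X d) : (n : ℕ) → H X (d * n)
  | 0 => unitClass X
  | n + 1 => cup (by ring : d * n + d = d * (n + 1)) (cupPow x n) x

end Singular

/-- The cross product `a × b = pr₁^*(a) ⌣ pr₂^*(b)`. By the Künneth theorem it identifies
`H^*(A) ⊗ H^*(B)` with `H^*(A × B)` when `H^*(B)` is of finite type, e.g. when `B = BK₄`. -/
def cross {A : Type u} {B : Type v} [TopologicalSpace A] [TopologicalSpace B] {p q n : ℕ}
    (h : p + q = n) (a : H A p) (b : H B q) : H (A × B) n :=
  cup h (pullback ContinuousMap.fst p a) (pullback ContinuousMap.snd q b)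

/-! ### The Klein four group and its universal space -/

/-- The Klein four group, as the group of pairs of signs. -/
abbrev K₄ : Type := ℤˣ × ℤˣ

/-- The infinite-dimensional sphere: the unit sphere of `ℓ²`. It is contractible. -/
abbrev SInf : Type := Metric.sphere (0 : ℓ²(ℕ, ℝ)) 1

/-- The action of a sign on the infinite-dimensional sphere. -/
def signMul (a : ℤˣ) (x : SInf) : SInf :=
  ⟨((a : ℤ) : ℝ) • (x : ℓ²(ℕ, ℝ)), by
    have hx : ‖(x : ℓ²(ℕ, ℝ))‖ = 1 := norm_eq_of_mem_sphere x
    rcases Int.units_eq_one_or a with rfl | rfl <;> simp [hx]⟩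

theorem signMul_one (x : SInf) : signMul 1 x = x := by
  ext1; simp [signMul]

theorem signMul_mul (a b : ℤˣ) (x : SInf) : signMul (a * b) x = signMul a (signMul b x) := by
  ext1; simp [signMul, mul_smul]

theorem continuous_signMul (a : ℤˣ) : Continuous (signMul a) := by
  unfold signMul; fun_prop

/-- The universal space `EK₄`: the contractible space `S^∞ × S^∞`, on which `K₄` acts freely by
signs. -/
def EK₄ : Type := SInf × SInf

instance : TopologicalSpace EK₄ := inferInstanceAs (TopologicalSpace (SInf × SInf))

instance : MulAction K₄ EK₄ where
  smul g e := (signMul g.1 e.1, signMul g.2 e.2)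
  one_smul e := Prod.ext (signMul_one _) (signMul_one _)
  mul_smul g h e := Prod.ext (signMul_mul _ _ _) (signMul_mul _ _ _)

instance : ContinuousConstSMul K₄ EK₄ where
  continuous_const_smul g :=
    ((continuous_signMul g.1).comp continuous_fst).prodMk
      ((continuous_signMul g.2).comp continuous_snd)

/-- A base point of `EK₄`. -/
def EK₄.base : EK₄ :=
  let x : SInf := ⟨lp.single 2 (0 : ℕ) (1 : ℝ), by simp [lp.norm_single]⟩
  (x, x)

/-- The classifying space `BK₄ = EK₄ / K₄`. -/
abbrev BK₄ : Type := MulAction.orbitRel.Quotient K₄ EK₄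

section Borel

variable (X : Type u) [TopologicalSpace X] [MulAction K₄ X] [ContinuousConstSMul K₄ X]

/-- The Borel construction `EK₄ ×_{K₄} X`, the quotient of `EK₄ × X` by the diagonal action.
The equivariant cohomology of `X` is the cohomology of this space. -/
abbrev Borel : Type u := MulAction.orbitRel.Quotient K₄ (EK₄ × X)

/-- The fixed-point space `X^{K₄}`. -/
abbrev Fixed : Type u := MulAction.fixedPoints K₄ X

/-- The inclusion `X → EK₄ ×_{K₄} X` of the fibre over the base point. -/
def fibreInclusion : C(X, Borel X) where
  toFun x := Quotient.mk _ (EK₄.base, x)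
  continuous_toFun := continuous_quotient_mk'.comp (by fun_prop)

/-- The restriction map `ρ : Hⁿ_{K₄}(X) → Hⁿ(X)`. -/
def restrictFibre (n : ℕ) : H (Borel X) n →ₗ[ZMod 2] H X n :=
  pullback (fibreInclusion X) n

/-- The inclusion `X^{K₄} × BK₄ = EK₄ ×_{K₄} X^{K₄} → EK₄ ×_{K₄} X`. -/
def fixedInclusion : C(Fixed X × BK₄, Borel X) where
  toFun p := Quotient.liftOn p.2 (fun e => (Quotient.mk _ (e, (p.1 : X)) : Borel X)) (by
    rintro a b ⟨g, rfl⟩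
    refine Quotient.sound ⟨g, ?_⟩
    exact Prod.ext rfl (p.1.2 g))
  continuous_toFun := by
    have hq : IsOpenQuotientMap (Quotient.mk (MulAction.orbitRel K₄ EK₄)) :=
      MulAction.isOpenQuotientMap_quotientMk
    refine ((IsOpenQuotientMap.id (X := Fixed X)).prodMap hq).isQuotientMap.continuous_iff.2 ?_
    change Continuous fun p : Fixed X × EK₄ => (Quotient.mk _ (p.2, (p.1 : X)) : Borel X)
    exact continuous_quotient_mk'.comp (by fun_prop)

/-- The restriction to the fixed points `r : Hⁿ_{K₄}(X) → Hⁿ(X^{K₄} × BK₄)`, whose target is the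
degree `n` part of `H^*(X^{K₄}) ⊗ H^*(BK₄)`. -/
def restrictFixed (n : ℕ) : H (Borel X) n →ₗ[ZMod 2] H (Fixed X × BK₄) n :=
  pullback (fixedInclusion X) n

end Borel

/-! ### Quaternionic conjugation spaces -/

/-- The Dickson invariant `p₀ = t t' (t + t')` of degree three. -/
def dickson₀ (t t' : H BK₄ 1) : H BK₄ 3 :=
  cup (by norm_num : 2 + 1 = 3) (cup (by norm_num : 1 + 1 = 2) t t') (t + t')

/-- The Dickson invariant `p₁ = t² + t t' + t'²` of degree two. -/
def dickson₁ (t t' : H BK₄ 1) : H BK₄ 2 :=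
  cup (by norm_num : 1 + 1 = 2) t t + cup (by norm_num : 1 + 1 = 2) t t' +
    cup (by norm_num : 1 + 1 = 2) t' t'

/-- The structure of a quaternionic conjugation space on a `K₄`-space `X`. The polynomial
generators `t, t'` of `H^*(BK₄) = 𝔽₂[t, t']` are the members of a basis of `H¹(BK₄)`;
the Dickson invariants do not depend on this basis. -/
structure ConjugationFrame (X : Type u) [TopologicalSpace X] [MulAction K₄ X]
    [ContinuousConstSMul K₄ X] where
  /-- The cohomology of `X` is concentrated in degrees divisible by four. -/
  vanishing : ∀ i : ℕ, ¬ 4 ∣ i → ∀ x : H X i, x = 0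
  /-- The polynomial generators `t, t'`. -/
  gen : Module.Basis (Fin 2) (ZMod 2) (H BK₄ 1)
  /-- The additive isomorphism `κ`, which divides degrees by four. -/
  κ : (n : ℕ) → H X (4 * n) ≃ₗ[ZMod 2] H (Fixed X) n
  /-- The additive section `σ` of the restriction map. -/
  σ : (n : ℕ) → H X n →ₗ[ZMod 2] H (Borel X) n
  section_σ : ∀ (n : ℕ) (x : H X n), restrictFibre X n (σ n x) = x
  /-- The quaternionic conjugation equation. -/
  conjugation_equation : ∀ (n : ℕ) (x : H X (4 * n)),
    ∃ c : (i j : ℕ) → H (Fixed X) (n + 3 * i + j),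
      restrictFixed X (4 * n) (σ (4 * n) x) =
        cross (by ring : n + 3 * n = 4 * n) (κ n x) (cupPow (dickson₀ (gen 0) (gen 1)) n) +
        ∑ i : Fin (n + 1), ∑ j : Fin (n + 1),
          if h : 0 < (i : ℕ) + j ∧ (i : ℕ) + j ≤ n then
            cross (by omega : (n + 3 * (i : ℕ) + j) + (2 * j + 3 * (n - j - i)) = 4 * n) (c i j)
              (cup rfl (cupPow (dickson₁ (gen 0) (gen 1)) j)
                (cupPow (dickson₀ (gen 0) (gen 1)) (n - j - i)))
          else 0

/-! ### Galois-maximality -/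

section Galois

variable (X : Type u) [TopologicalSpace X] [MulAction K₄ X] [ContinuousConstSMul K₄ X]

/-- The self-homeomorphism of `X` given by an element of `K₄`. -/
def translation (g : K₄) : C(X, X) := ⟨fun x => g • x, continuous_const_smul g⟩

/-- The action of `K₄` on `Hⁱ(X; 𝔽₂)`: the element `g` acts as `(g⁻¹)^*`. -/
def cohomologyRep (i : ℕ) : Representation (ZMod 2) K₄ (H X i) where
  toFun g := pullback (translation X g⁻¹) i
  map_one' := by
    have h : translation X (1 : K₄)⁻¹ = ContinuousMap.id X := by
      ext x; simp [translation]
    rw [h, pullback_id]; rfl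
  map_mul' g h := by
    have e : translation X (g * h)⁻¹ = (translation X h⁻¹).comp (translation X g⁻¹) := by
      ext x
      change (g * h)⁻¹ • x = h⁻¹ • g⁻¹ • x
      rw [mul_inv_rev, mul_smul]
    rw [e, pullback_comp]; rfl

/-- The dimension of a vector space, as an element of `[0, ∞]`. -/
def dim (F : Type w) (V : Type v) [Semiring F] [AddCommMonoid V] [Module F V] : ℝ≥0∞ :=
  ((Cardinal.toENat (Module.rank F V) : ℕ∞) : ℝ≥0∞)

/-- A representation of `K₄` over `𝔽₂`, with field and group lifted to the universe of the
underlying vector space, as needed for `groupCohomology`. -/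
def liftRep {V : Type u} [AddCommGroup V] [Module (ZMod 2) V]
    (τ : Representation (ZMod 2) K₄ V) :
    Representation (ULift.{u} (ZMod 2)) (ULift.{u} K₄) V where
  toFun g :=
    { toFun := τ g.down
      map_add' := map_add (τ g.down)
      map_smul' := fun a v => map_smul (τ g.down) a.down v }
  map_one' := by ext v; exact LinearMap.congr_fun τ.map_one v
  map_mul' g h := by ext v; exact LinearMap.congr_fun (τ.map_mul g.down h.down) v

/-- The dimension over `𝔽₂` of the group cohomology `H¹(K₄; V)`. -/
def dimGroupH1 {V : Type u} [AddCommGroup V] [Module (ZMod 2) V]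
    (τ : Representation (ZMod 2) K₄ V) : ℝ≥0∞ :=
  dim (ULift.{u} (ZMod 2)) (groupCohomology (Rep.of (liftRep τ)) 1)

/-- The total mod two Betti number of a space. -/
def totalBetti (Y : Type v) [TopologicalSpace Y] : ℝ≥0∞ := ∑' i : ℕ, dim (ZMod 2) (H Y i)

/-- A `K₄`-space `X` is `K₄`-Galois-maximal if
`∑ᵢ dim Hⁱ(X^{K₄}; 𝔽₂) = ½ ∑ᵢ dim H¹(K₄; Hⁱ(X; 𝔽₂))`. -/
def IsGaloisMaximal : Prop :=
  totalBetti (Fixed X) = (1 / 2) * ∑' i : ℕ, dimGroupH1 (cohomologyRep X i)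

end Galois

end QuaternionicConjugation

end

/-! The group acts trivially on `H X i`. In the Borel construction the point `[e₀, g x]` equals
`[g⁻¹ e₀, x]`, so a path in `EK₄` from `e₀` to `g⁻¹ e₀` gives a homotopy from the fibre inclusion to
its composite with translation by `g`. By homotopy invariance (`pullback_eq_of_homotopy`, via the
prism operator), every class in the image of `ρ` is invariant. The section `σ` makes `ρ` surjective,
so every class of `X` is invariant (`ConjugationFrame.cohomologyRep_isTrivial`).

For trivial coefficients `H¹(K₄; V) = Hom(K₄, V) = V × V`, so half the sum of the dimensions is the
total Betti number of `X` (`dimGroupH1_of_isTrivial`). Since the cohomology of `X` lives in degrees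
`4n`, and `κ` matches degree `4n` with degree `n` of the fixed points, this is also the total Betti
number of the fixed points (`ConjugationFrame.totalBetti_fixed`). -/

noncomputable section

namespace QuaternionicConjugation

universe u v w

/-! ### Homotopy invariance of singular cohomology -/

section Homotopy

/-- The summation identity behind the prism operator: the diagonal terms telescope and the
others pair off. -/
theorem sum_prism {R : Type*} [CommRing R] [CharP R 2] (n : ℕ) (a b : ℕ → ℕ → R) (e : ℕ → R)
    (h₁ : ∀ i j, j ≤ i → i < n → a (i + 1) j = b j i)
    (h₂ : ∀ i, i ≤ n → a i i = e i) (h₃ : ∀ i, i ≤ n → a i (i + 1) = e (i + 1))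
    (h₄ : ∀ i j, i < j → j ≤ n → a i (j + 1) = b j i) :
    ∑ i ∈ Finset.range (n + 1), ∑ j ∈ Finset.range (n + 2), a i j =
      e 0 + e (n + 1) + ∑ j ∈ Finset.range (n + 1), ∑ i ∈ Finset.range n, b j i := by
  -- Each row is cut at its two diagonal entries `j = i` and `j = i + 1`; for `i = 0` the part with
  -- `i - 1` is empty.
  have split : ∀ i ∈ Finset.range (n + 1), ∑ j ∈ Finset.range (n + 2), a i j =
      ∑ j ∈ Finset.range i, b j (i - 1) + (e i + e (i + 1)) +
        ∑ j ∈ Finset.Ico (i + 1) (n + 1), b j i := by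
    intro i hi
    have hi' : i ≤ n := Nat.lt_succ_iff.1 (Finset.mem_range.1 hi)
    rw [← Finset.sum_range_add_sum_Ico _ (by omega : i + 2 ≤ n + 2), Finset.sum_range_succ,
      Finset.sum_range_succ, h₂ i hi', h₃ i hi', ← Finset.sum_Ico_add' (a i) (i + 1) (n + 1) 1,
      add_assoc (∑ j ∈ Finset.range i, a i j)]
    congr 1
    · congr 1
      refine Finset.sum_congr rfl fun j hj => ?_
      have hj' := Finset.mem_range.1 hj
      obtain ⟨k, rfl⟩ : ∃ k, i = k + 1 := ⟨i - 1, by omega⟩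
      exact h₁ k j (by omega) (by omega)
    · refine Finset.sum_congr rfl fun j hj => ?_
      have hj' := Finset.mem_Ico.1 hj
      exact h₄ i j (by omega) (by omega)
  have telescope : ∀ m : ℕ, ∑ i ∈ Finset.range m, (e i + e (i + 1)) = e 0 + e m := by
    intro m
    induction m with
    | zero => simp [CharTwo.add_self_eq_zero]
    | succ m ih =>
      rw [Finset.sum_range_succ, ih]
      linear_combination CharTwo.add_self_eq_zero (e m)
  rw [Finset.sum_congr rfl split, Finset.sum_add_distrib, Finset.sum_add_distrib, telescope,
    Finset.sum_range_succ' (fun i => ∑ j ∈ Finset.range i, b j (i - 1)),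
    Finset.sum_range_succ (fun i => ∑ j ∈ Finset.Ico (i + 1) (n + 1), b j i), Finset.sum_comm]
  -- For fixed `i`, the lower part of row `i + 1` and the upper part of row `i` fill the whole range
  -- of `j`.
  have recombine : ∀ i ∈ Finset.range n, ∑ j ∈ Finset.range (n + 1), b j i =
      ∑ j ∈ Finset.range (i + 1), b j (i + 1 - 1) +
        ∑ j ∈ Finset.Ico (i + 1) (n + 1), b j i := by
    intro i hi
    have hi' := Finset.mem_range.1 hi
    rw [Nat.add_sub_cancel, Finset.sum_range_add_sum_Ico _ (by omega : i + 1 ≤ n + 1)]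
  rw [Finset.sum_congr rfl recombine, Finset.sum_add_distrib]
  simp only [Finset.range_zero, Finset.sum_empty, Finset.Ico_self]
  ring

/-- The simplicial map of the standard simplex to the unit interval with given values on the
vertices. -/
def simplexTime {m : ℕ} (ψ : Fin (m + 1) → Fin 2) :
    C(stdSimplex ℝ (Fin (m + 1)), unitInterval) :=
  (stdSimplexHomeomorphUnitInterval : C(_, _)).comp ⟨stdSimplex.map ψ, stdSimplex.continuous_map ψ⟩

theorem simplexTime_apply {m : ℕ} (ψ : Fin (m + 1) → Fin 2) (x : stdSimplex ℝ (Fin (m + 1))) :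
    simplexTime ψ x = stdSimplexHomeomorphUnitInterval (stdSimplex.map ψ x) := rfl

theorem coe_simplexTime {m : ℕ} (ψ : Fin (m + 1) → Fin 2) (x : stdSimplex ℝ (Fin (m + 1))) :
    (simplexTime ψ x : ℝ) = ∑ k with ψ k = 1, x k := by
  -- The homeomorphism with the interval reads off the barycentric coordinate at vertex `1`.
  change (stdSimplex.map ψ x) 1 = _
  rw [stdSimplex.map_coe, FunOnFinite.linearMap_apply_apply]

theorem simplexTime_zero {m : ℕ} (x : stdSimplex ℝ (Fin (m + 1))) :
    simplexTime (fun _ => 0) x = 0 := by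
  ext
  simp [coe_simplexTime]

theorem simplexTime_one {m : ℕ} (x : stdSimplex ℝ (Fin (m + 1))) :
    simplexTime (fun _ => 1) x = 1 := by
  ext
  simp [coe_simplexTime]

variable {X : Type u} {Y : Type v} [TopologicalSpace X] [TopologicalSpace Y] {f g : C(X, Y)}

/-- The simplex of `Y` obtained by applying a homotopy to a simplex of `[0, 1] × X`, whose
components are simplicial with vertices `ψ` and `φ`. -/
def prismSimplex (F : f.Homotopy g) {m n : ℕ} (φ : Fin (m + 1) → Fin (n + 1))
    (ψ : Fin (m + 1) → Fin 2) (s : Simplex n X) : Simplex m Y :=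
  F.toContinuousMap.comp ((simplexTime ψ).prodMk (s.reindex φ))

theorem prismSimplex_reindex (F : f.Homotopy g) {l m n : ℕ} (φ : Fin (m + 1) → Fin (n + 1))
    (ψ : Fin (m + 1) → Fin 2) (χ : Fin (l + 1) → Fin (m + 1)) (s : Simplex n X) :
    (prismSimplex F φ ψ s).reindex χ = prismSimplex F (φ ∘ χ) (ψ ∘ χ) s := by
  ext x
  simp [prismSimplex, Simplex.reindex, simplexTime_apply, stdSimplex.map_comp_apply]

theorem reindex_prismSimplex (F : f.Homotopy g) {l m n : ℕ} (φ : Fin (m + 1) → Fin (n + 1))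
    (ψ : Fin (m + 1) → Fin 2) (χ : Fin (n + 1) → Fin (l + 1)) (s : Simplex l X) :
    prismSimplex F φ ψ (s.reindex χ) = prismSimplex F (χ ∘ φ) ψ s := by
  rw [prismSimplex, Simplex.reindex_reindex, prismSimplex]

theorem prismSimplex_zero (F : f.Homotopy g) {n : ℕ} (s : Simplex n X) :
    prismSimplex F id (fun _ => 0) s = f.comp s := by
  ext x
  simp [prismSimplex, Simplex.reindex, simplexTime_zero]

theorem prismSimplex_one (F : f.Homotopy g) {n : ℕ} (s : Simplex n X) :
    prismSimplex F id (fun _ => 1) s = g.comp s := by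
  ext x
  simp [prismSimplex, Simplex.reindex, simplexTime_one]

/-- A vertex map given by natural numbers. -/
def vertexMap (m n : ℕ) (a : ℕ → ℕ) : Fin (m + 1) → Fin (n + 1) :=
  -- The truncation only makes the map total: it never acts on the index formulas in the ranges used
  -- below.
  fun k => ⟨min (a k) n, by omega⟩

/-- The vertex map of the `i`-th degeneracy. -/
def degeneracyIndex (i k : ℕ) : ℕ := if k ≤ i then k else k - 1

/-- The vertex map of the `j`-th face. -/
def faceIndex (j k : ℕ) : ℕ := if k < j then k else k + 1

/-- The vertices at the end of the interval, starting from the `i`-th. -/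
def stepIndex (i k : ℕ) : ℕ := if k < i then 0 else 1

/-- The prism operator of a homotopy. -/
def prism (F : f.Homotopy g) (n : ℕ) : Cochain Y (n + 1) →ₗ[ZMod 2] Cochain X n where
  toFun c s := ∑ i ∈ Finset.range (n + 1),
    c (prismSimplex F (vertexMap (n + 1) n (degeneracyIndex i))
      (vertexMap (n + 1) 1 (stepIndex (i + 1))) s)
  map_add' c d := by ext s; simp [Finset.sum_add_distrib]
  map_smul' a c := by ext s; simp [Finset.mul_sum]

/-- Natural-number formulas for faces and degeneracies reduce the simplicial identities to case
splits and `omega`. -/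
theorem succAbove_eq_vertexMap {n : ℕ} (j : Fin (n + 2)) :
    j.succAbove = vertexMap n (n + 1) (faceIndex j) := by
  ext k
  simp only [Fin.succAbove, Fin.lt_def, Fin.val_castSucc, vertexMap, faceIndex]
  split_ifs <;> simp <;> omega

/-- The prism operator is a chain homotopy, up to the faces of the base. -/
theorem prism_coboundary (F : f.Homotopy g) (n : ℕ) (c : Cochain Y n) (s : Simplex n X) :
    prism F n (coboundary Y n c) s = c (g.comp s) + c (f.comp s) +
      ∑ j ∈ Finset.range (n + 1), ∑ i ∈ Finset.range n,
        c (prismSimplex F (vertexMap n n (faceIndex j ∘ degeneracyIndex i))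
          (vertexMap n 1 (stepIndex (i + 1))) s) := by
  -- The entry `e i` is the wall shared by consecutive prism pieces: its vertices from `i` on lie at
  -- time `1`. Thus `e 0` is the `g` end and `e (n + 1)` the `f` end, while `b j i` is a piece of
  -- the prism over the `j`-th face.
  have key := sum_prism (R := ZMod 2) n
    (fun i j => c (prismSimplex F (vertexMap n n (degeneracyIndex i ∘ faceIndex j))
      (vertexMap n 1 (stepIndex (i + 1) ∘ faceIndex j)) s))
    (fun j i => c (prismSimplex F (vertexMap n n (faceIndex j ∘ degeneracyIndex i))
          (vertexMap n 1 (stepIndex (i + 1))) s))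
    (fun i => c (prismSimplex F id (vertexMap n 1 (stepIndex i)) s)) ?_ ?_ ?_ ?_
  · have h0 : vertexMap n 1 (stepIndex 0) = fun _ => 1 := by
      ext k; simp [vertexMap, stepIndex]
    have h1 : vertexMap n 1 (stepIndex (n + 1)) = fun _ => 0 := by
      ext k; simp [vertexMap, stepIndex, Fin.is_le]
    rw [h0, h1, prismSimplex_zero, prismSimplex_one] at key
    rw [← key]
    change ∑ i ∈ Finset.range (n + 1), ∑ j : Fin (n + 2), _ = _
    refine Finset.sum_congr rfl fun i hi => ?_
    have hi' := Finset.mem_range.1 hi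
    rw [Finset.sum_range]
    refine Finset.sum_congr rfl fun j _ => ?_
    rw [Simplex.face, prismSimplex_reindex, succAbove_eq_vertexMap]
    congr 2
    · ext k
      simp only [Function.comp, vertexMap, faceIndex, degeneracyIndex]
      split_ifs <;> omega
    · ext k
      simp only [Function.comp, vertexMap, faceIndex, stepIndex]
      split_ifs <;> omega
  all_goals
    intros
    congr 2
    all_goals
      ext k
      simp only [Function.comp, vertexMap, faceIndex, degeneracyIndex, stepIndex, id]
      split_ifs <;> omega

/-- Passing to a face of the base changes only the base vertex map, so this is exactly the double
sum left over in `prism_coboundary`. -/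
theorem coboundary_prism (F : f.Homotopy g) (n : ℕ) (c : Cochain Y (n + 1))
    (s : Simplex (n + 1) X) :
    coboundary X n (prism F n c) s =
      ∑ j ∈ Finset.range (n + 2), ∑ i ∈ Finset.range (n + 1),
        c (prismSimplex F (vertexMap (n + 1) (n + 1) (faceIndex j ∘ degeneracyIndex i))
          (vertexMap (n + 1) 1 (stepIndex (i + 1))) s) := by
  rw [Finset.sum_range]
  change ∑ j : Fin (n + 2), ∑ i ∈ Finset.range (n + 1), _ = _
  refine Finset.sum_congr rfl fun j _ => Finset.sum_congr rfl fun i hi => ?_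
  have hi' := Finset.mem_range.1 hi
  rw [Simplex.face, reindex_prismSimplex, succAbove_eq_vertexMap]
  congr 2
  ext k
  simp only [Function.comp, vertexMap, faceIndex, degeneracyIndex]
  split_ifs <;> omega

/-- Homotopic maps induce the same map on singular cohomology. -/
theorem pullback_eq_of_homotopy (F : f.Homotopy g) (n : ℕ) : pullback f n = pullback g n := by
  ext c
  refine (Submodule.Quotient.eq _).2 ?_
  change Cochain.pullback f n c.1 - Cochain.pullback g n c.1 ∈ coboundaries X n
  have hc : coboundary Y n c.1 = 0 := c.2
  -- In degree zero `coboundaries` is `⊥`, so the difference itself must vanish; in positive degree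
  -- the prism operator supplies a primitive.
  cases n with
  | zero =>
    have h0 : Cochain.pullback f 0 c.1 - Cochain.pullback g 0 c.1 = 0 := by
      ext s
      have h := prism_coboundary F 0 c.1 s
      rw [hc, map_zero] at h
      simp only [Pi.zero_apply, Finset.range_zero, Finset.sum_empty, Finset.sum_const_zero,
        add_zero] at h
      change c.1 (f.comp s) - c.1 (g.comp s) = 0
      rw [CharTwo.sub_eq_add, add_comm, ← h]
    rw [h0]
    exact zero_mem _
  | succ n =>
    refine ⟨prism F n c.1, ?_⟩
    ext s
    have h := prism_coboundary F (n + 1) c.1 s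
    rw [hc, map_zero, ← coboundary_prism] at h
    change coboundary X n (prism F n c.1) s = c.1 (f.comp s) - c.1 (g.comp s)
    rw [CharTwo.sub_eq_add, add_comm (c.1 (f.comp s))]
    exact (CharTwo.add_eq_zero.1 h.symm).symm

end Homotopy

/-! ### The action on the cohomology of a conjugation space is trivial -/

/-- Two coordinate vectors suffice; dimension above one makes the unit sphere path connected. -/
theorem one_lt_rank_lTwo : 1 < Module.rank ℝ ℓ²(ℕ, ℝ) := by
  have hli : LinearIndependent ℝ
      ![(lp.single 2 (0 : ℕ) (1 : ℝ) : ℓ²(ℕ, ℝ)), lp.single 2 (1 : ℕ) (1 : ℝ)] := by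
    rw [LinearIndependent.pair_iff]
    intro a b hab
    have h0 := congrArg (fun x : ℓ²(ℕ, ℝ) => (x : ℕ → ℝ) 0) hab
    have h1 := congrArg (fun x : ℓ²(ℕ, ℝ) => (x : ℕ → ℝ) 1) hab
    change a * (lp.single 2 (0 : ℕ) (1 : ℝ) : ℓ²(ℕ, ℝ)) 0 +
      b * (lp.single 2 (1 : ℕ) (1 : ℝ) : ℓ²(ℕ, ℝ)) 0 = 0 at h0
    change a * (lp.single 2 (0 : ℕ) (1 : ℝ) : ℓ²(ℕ, ℝ)) 1 +
      b * (lp.single 2 (1 : ℕ) (1 : ℝ) : ℓ²(ℕ, ℝ)) 1 = 0 at h1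
    constructor
    · simpa using h0
    · simpa using h1
  have h := hli.cardinal_le_rank
  rw [Cardinal.mk_fin] at h
  exact lt_of_lt_of_le (by norm_num) h

instance : PathConnectedSpace SInf :=
  isPathConnected_iff_pathConnectedSpace.1
    (isPathConnected_sphere one_lt_rank_lTwo 0 zero_le_one)

/-- This is all that the argument needs of the contractibility of `EK₄`. -/
instance : PathConnectedSpace EK₄ :=
  inferInstanceAs (PathConnectedSpace (SInf × SInf))

section Action

variable (X : Type u) [TopologicalSpace X] [MulAction K₄ X] [ContinuousConstSMul K₄ X]

/-- The inclusion of the fibre into the Borel construction is homotopic to its translates. -/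
def fibreInclusionHomotopy (g : K₄) :
    (fibreInclusion X).Homotopy ((fibreInclusion X).comp (translation X g)) where
  toFun p := Quotient.mk _
    (PathConnectedSpace.somePath EK₄.base (g⁻¹ • EK₄.base) p.1, p.2)
  continuous_toFun := continuous_quotient_mk'.comp (by fun_prop)
  map_zero_left x := by simp [fibreInclusion]
  map_one_left x := by
    simp only [Path.target]
    -- Acting by `g⁻¹` on `(e₀, g x)` gives `(g⁻¹ e₀, x)`, the end of the path.
    refine Quotient.sound ⟨g⁻¹, ?_⟩
    exact Prod.ext rfl (inv_smul_smul g x)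

theorem pullback_translation_restrictFibre (g : K₄) (n : ℕ) (y : H (Borel X) n) :
    pullback (translation X g) n (restrictFibre X n y) = restrictFibre X n y := by
  have h := pullback_eq_of_homotopy (fibreInclusionHomotopy X g) n
  rw [pullback_comp] at h
  exact (LinearMap.congr_fun h y).symm

variable {X} in
-- Every class is the restriction of its lift under `σ`, and restrictions to the fibre are
-- invariant.
theorem ConjugationFrame.cohomologyRep_isTrivial (frame : ConjugationFrame X) (i : ℕ) :
    (cohomologyRep X i).IsTrivial where
  out g := by
    refine LinearMap.ext fun x => ?_
    change pullback (translation X g⁻¹) i x = x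
    rw [← frame.section_σ i x, pullback_translation_restrictFibre]

end Action

/-! ### First cohomology of the Klein four group with trivial coefficients -/

section TrivialCoefficients

/-- The homomorphism from signs to a vector space over `𝔽₂` with a given value at `-1`. -/
def signHom {V : Type u} [AddCommGroup V] [Module (ZMod 2) V] (x : V) : Additive ℤˣ →+ V where
  toFun a := if a.toMul = 1 then 0 else x
  map_zero' := by simp
  map_add' a b := by
    have hx : x + x = 0 := ZModModule.add_self x
    induction a using Additive.rec with | _ a =>
    induction b using Additive.rec with | _ b =>
    rw [← ofMul_mul]
    rcases Int.units_eq_one_or a with rfl | rfl <;> rcases Int.units_eq_one_or b with rfl | rfl <;>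
      simp [hx]

theorem additive_units_int_hom_ext {V : Type u} [AddCommGroup V] {f g : Additive ℤˣ →+ V}
    (h : f (Additive.ofMul (-1)) = g (Additive.ofMul (-1))) : f = g := by
  refine AddMonoidHom.ext fun a => ?_
  induction a using Additive.rec with | _ a =>
  rcases Int.units_eq_one_or a with rfl | rfl
  · rw [ofMul_one, map_zero, map_zero]
  · exact h

/-- A homomorphism from the Klein four group to a vector space over `𝔽₂` is given by a pair of
vectors. -/
def homK₄Equiv (V : Type u) [AddCommGroup V] [Module (ZMod 2) V] :
    (Additive (ULift.{u} K₄) →+ V) ≃ₗ[ULift.{u} (ZMod 2)] V × V where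
  toFun f := (f (Additive.ofMul ⟨(-1, 1)⟩), f (Additive.ofMul ⟨(1, -1)⟩))
  map_add' _ _ := rfl
  map_smul' _ _ := rfl
  invFun p :=
    { toFun := fun a => signHom p.1 (Additive.ofMul a.toMul.down.1) +
        signHom p.2 (Additive.ofMul a.toMul.down.2)
      map_zero' := by simp
      map_add' := fun a b => by
        simp only [toMul_add, ULift.mul_down, Prod.fst_mul, Prod.snd_mul, ofMul_mul, map_add]
        abel }
  left_inv f := by
    refine AddMonoidHom.ext fun a => ?_
    induction a using Additive.rec with | _ a =>
    obtain ⟨a, b⟩ := a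
    -- Since `(a, b) = (a, 1) * (1, b)`, it is enough to recover `f` on each factor.
    have hl : signHom (f (Additive.ofMul ⟨(-1, 1)⟩)) (Additive.ofMul a) =
        f (Additive.ofMul ⟨(a, 1)⟩) := by
      rcases Int.units_eq_one_or a with rfl | rfl
      · exact (map_zero (signHom _)).trans (map_zero f).symm
      · simp [signHom]
    have hr : signHom (f (Additive.ofMul ⟨(1, -1)⟩)) (Additive.ofMul b) =
        f (Additive.ofMul ⟨(1, b)⟩) := by
      rcases Int.units_eq_one_or b with rfl | rfl
      · exact (map_zero (signHom _)).trans (map_zero f).symm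
      · simp [signHom]
    change signHom (f (Additive.ofMul ⟨(-1, 1)⟩)) (Additive.ofMul a) +
      signHom (f (Additive.ofMul ⟨(1, -1)⟩)) (Additive.ofMul b) = _
    rw [hl, hr, ← map_add, ← ofMul_mul]
    congr 2
    exact ULift.ext _ _ (Prod.ext (mul_one a) (one_mul b))
  right_inv p := by
    ext <;> simp [signHom]

/-- Removes the universe lift of the field that `groupCohomology` imposes. -/
theorem rank_ulift_zmod (V : Type u) [AddCommGroup V] [Module (ZMod 2) V] :
    Module.rank (ULift.{u} (ZMod 2)) V = Module.rank (ZMod 2) V :=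
  rank_eq_of_equiv_equiv (ULift.ringEquiv (R := ZMod 2)) (AddEquiv.refl V)
    ULift.ringEquiv.bijective fun _ _ => rfl

/-- For trivial coefficients, `H¹(K₄; V)` has twice the dimension of `V`. -/
theorem dimGroupH1_of_isTrivial {V : Type u} [AddCommGroup V] [Module (ZMod 2) V]
    (τ : Representation (ZMod 2) K₄ V) [τ.IsTrivial] :
    dimGroupH1 τ = 2 * dim (ZMod 2) V := by
  have : (liftRep τ).IsTrivial := ⟨fun g => by
    ext v
    exact τ.isTrivial_apply g.down v⟩
  have e : groupCohomology (Rep.of (liftRep τ)) 1 ≃ₗ[ULift.{u} (ZMod 2)] V × V :=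
    (groupCohomology.H1IsoOfIsTrivial (Rep.of (liftRep τ))).toLinearEquiv ≪≫ₗ homK₄Equiv V
  have : Fact (Nat.Prime 2) := ⟨Nat.prime_two⟩
  rw [dimGroupH1, dim, dim, e.rank_eq, rank_prod', rank_ulift_zmod, map_add, two_mul,
    ENat.toENNReal_add]

end TrivialCoefficients

/-! ### Galois-maximality -/

theorem dim_eq_of_linearEquiv {V : Type v} {W : Type v} [AddCommGroup V] [AddCommGroup W]
    [Module (ZMod 2) V] [Module (ZMod 2) W] (e : V ≃ₗ[ZMod 2] W) :
    dim (ZMod 2) V = dim (ZMod 2) W := by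
  rw [dim, dim, e.rank_eq]

/-- The Betti sum of `X` is supported on multiples of four; reindexing it by `n ↦ 4 * n` lets `κ`
compare the sums term by term. -/
theorem ConjugationFrame.totalBetti_fixed {X : Type u} [TopologicalSpace X] [MulAction K₄ X]
    [ContinuousConstSMul K₄ X] (frame : ConjugationFrame X) :
    totalBetti (Fixed X) = totalBetti X := by
  have hinj : Function.Injective fun n : ℕ => 4 * n := fun a b h => by
    dsimp only at h
    omega
  have hsupp : (Function.support fun i : ℕ => dim (ZMod 2) (H X i)) ⊆
      Set.range fun n : ℕ => 4 * n := by
    intro i hi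
    by_contra hn
    refine hi ?_
    have hi4 : ¬ 4 ∣ i := fun ⟨k, hk⟩ => hn ⟨k, hk.symm⟩
    have : Subsingleton (H X i) :=
      subsingleton_of_forall_eq 0 (frame.vanishing i hi4)
    change dim (ZMod 2) (H X i) = 0
    rw [dim, rank_subsingleton']
    simp
  rw [totalBetti, totalBetti, ← hinj.tsum_eq hsupp]
  exact tsum_congr fun n => (dim_eq_of_linearEquiv (frame.κ n)).symm

end QuaternionicConjugation

end

theorem mainTheorem3 {X : Type*} [TopologicalSpace X] [MulAction QuaternionicConjugation.K₄ X]
    [ContinuousConstSMul QuaternionicConjugation.K₄ X]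
    (frame : QuaternionicConjugation.ConjugationFrame X) :
    QuaternionicConjugation.IsGaloisMaximal X := by
  have h : ∀ i : ℕ,
      QuaternionicConjugation.dimGroupH1 (QuaternionicConjugation.cohomologyRep X i) =
        2 * QuaternionicConjugation.dim (ZMod 2) (QuaternionicConjugation.H X i) := fun i =>
    have := frame.cohomologyRep_isTrivial i
    QuaternionicConjugation.dimGroupH1_of_isTrivial _
  rw [QuaternionicConjugation.IsGaloisMaximal, frame.totalBetti_fixed]
  simp_rw [h]
  -- Cancelling `2⁻¹ * 2` needs only that `2` is neither `0` nor `∞`, so infinite Betti sums are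
  -- covered.
  rw [ENNReal.tsum_mul_left, ← mul_assoc, one_div,
    ENNReal.inv_mul_cancel two_ne_zero ENNReal.ofNat_ne_top, one_mul]
  rfl
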